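/- Let $K$ be an algebraically closed field and let $K^{n_1,n_2,n_3}$ be the space of $n_1\times n_2\times n_3$ tensors over $K$. The subrank of $T\in K^{n_1,n_2,n_3}$ is the largest $r$ for which there are matrices $A\in K^{r\times n_1}$, $B\in K^{r\times n_2}$, $C\in K^{r\times n_3}$ such that, for all $i,j,k\in\{1,\dots,r\}$, the sum $\sum_{a,b,c}A_{ia}B_{jb}C_{kc}T_{abc}$ equals $1$ if $i=j=k$ and $0$ otherwise. The subrank is constant on some nonempty Zariski-open subset of $K^{n_1,n_2,n_3}$; its value there is the generic subrank $\mathrm{Q}(n_1,n_2,n_3)$. For a subspace $\mathcal X\subseteq \mathrm{Mat}_{r,r}(K)$ and $i\in\{1,2,3\}$, let $\mathcal X[i]\subseteq K^{r,r,r}$ be the subspace of tensors all of whose slices in the $i$-th direction lie in $\mathcal X$, and let $W_r=\{T\in K^{r,r,r} : T_{ijk}=0 \text{ whenever } i,j,k \text{ are pairwise distinct}\}$. A property holds for generic subspaces of given dimensions if it holds on a nonempty Zariski-open subset of the product of the corresponding Grassmannians. **Theorem.** Let $r\le n_1,n_2,n_3$ with $n_i-r\le r^2$ for $i=1,2,3$.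 If $$\mathcal X_1[1]+\mathcal X_2[2]+\mathcal X_3[3]+W_r=K^{r,r,r}$$ for generic subspaces $\mathcal X_i\subseteq\mathrm{Mat}_{r,r}(K)$ of dimension $n_i-r$ $(i=1,2,3)$, then $\mathrm{Q}(n_1,n_2,n_3)\ge r$. If $K$ has characteristic $0$, the converse also holds: if $\mathrm{Q}(n_1,n_2,n_3)\ge r$, then the displayed equality holds for generic subspaces $\mathcal X_i\subseteq\mathrm{Mat}_{r,r}(K)$ of dimension $n_i-r$. -/

import Mathlib

namespace GenericSubrank

/-- The space of `n₁ × n₂ × n₃` tensors (3-dimensional arrays) with entries in `K`. -/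
abbrev Tensor (K : Type*) (n₁ n₂ n₃ : ℕ) : Type _ := Fin n₁ × Fin n₂ × Fin n₃ → K

/-- The restriction preorder: `S` is obtained from `T` by applying matrices `A`, `B`, `C` to the
three legs of `T`. -/
def Restricts {K : Type*} [Field K] {n₁ n₂ n₃ m₁ m₂ m₃ : ℕ}
    (S : Tensor K n₁ n₂ n₃) (T : Tensor K m₁ m₂ m₃) : Prop :=
  ∃ (A : Matrix (Fin n₁) (Fin m₁) K) (B : Matrix (Fin n₂) (Fin m₂) K)
    (C : Matrix (Fin n₃) (Fin m₃) K),
    ∀ i j k, S (i, j, k) = ∑ a, ∑ b, ∑ c, A i a * B j b * C k c * T (a, b, c)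

/-- The diagonal tensor `I_r`: entries `1` on the main diagonal and `0` elsewhere. -/
def unitTensor (K : Type*) [Field K] (r : ℕ) : Tensor K r r r :=
  fun p => if p.1 = p.2.1 ∧ p.2.1 = p.2.2 then 1 else 0

/-- The subrank of `T`: the largest `r` such that `I_r` is a restriction of `T`. (The set is
nonempty, as it contains `0`, and bounded by each of the three dimensions.) -/
noncomputable def subrank {K : Type*} [Field K] {n₁ n₂ n₃ : ℕ} (T : Tensor K n₁ n₂ n₃) : ℕ :=
  sSup {r : ℕ | Restricts (unitTensor K r) T}

/-- Zariski-open subsets of the affine space `σ → K`: the complement is the common zero set of a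
finite collection of polynomials. -/
def IsZariskiOpen {K σ : Type*} [Field K] (U : Set (σ → K)) : Prop :=
  ∃ F : Finset (MvPolynomial σ K), Uᶜ = {x | ∀ p ∈ F, MvPolynomial.eval x p = 0}

/-- `q` is the value of the subrank on some nonempty Zariski-open set of tensors. -/
def IsGenericSubrank (K : Type*) [Field K] (n₁ n₂ n₃ q : ℕ) : Prop :=
  ∃ U : Set (Tensor K n₁ n₂ n₃), U.Nonempty ∧ IsZariskiOpen U ∧ ∀ T ∈ U, subrank T = q

/-- The generic subrank `Q(n₁, n₂, n₃)`: the number `q` with `IsGenericSubrank K n₁ n₂ n₃ q`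
(over an algebraically closed field there is exactly one). -/
noncomputable def genericSubrank (K : Type*) [Field K] (n₁ n₂ n₃ : ℕ) : ℕ :=
  sInf {q : ℕ | IsGenericSubrank K n₁ n₂ n₃ q}

/-- `X[1]`: the tensors all of whose slices in the first direction lie in `X`. -/
def tensorLeg₁ {K : Type*} [Field K] (n₁ : ℕ) {n₂ n₃ : ℕ}
    (X : Submodule K (Matrix (Fin n₂) (Fin n₃) K)) : Submodule K (Tensor K n₁ n₂ n₃) where
  carrier := {T | ∀ i, (Matrix.of fun j k => T (i, j, k)) ∈ X}
  add_mem' hS hT i := X.add_mem (hS i) (hT i)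
  zero_mem' _ := X.zero_mem
  smul_mem' c _ hT i := X.smul_mem c (hT i)

/-- `X[2]`: the tensors all of whose slices in the second direction lie in `X`. -/
def tensorLeg₂ {K : Type*} [Field K] (n₂ : ℕ) {n₁ n₃ : ℕ}
    (X : Submodule K (Matrix (Fin n₁) (Fin n₃) K)) : Submodule K (Tensor K n₁ n₂ n₃) where
  carrier := {T | ∀ j, (Matrix.of fun i k => T (i, j, k)) ∈ X}
  add_mem' hS hT j := X.add_mem (hS j) (hT j)
  zero_mem' _ := X.zero_mem
  smul_mem' c _ hT j := X.smul_mem c (hT j)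

/-- `X[3]`: the tensors all of whose slices in the third direction lie in `X`. -/
def tensorLeg₃ {K : Type*} [Field K] (n₃ : ℕ) {n₁ n₂ : ℕ}
    (X : Submodule K (Matrix (Fin n₁) (Fin n₂) K)) : Submodule K (Tensor K n₁ n₂ n₃) where
  carrier := {T | ∀ k, (Matrix.of fun i j => T (i, j, k)) ∈ X}
  add_mem' hS hT k := X.add_mem (hS k) (hT k)
  zero_mem' _ := X.zero_mem
  smul_mem' c _ hT k := X.smul_mem c (hT k)

/-- `W_r`: the tensors that vanish on all entries with pairwise distinct indices. -/
def distinctVanishing (K : Type*) [Field K] (r : ℕ) : Submodule K (Tensor K r r r) where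
  carrier := {T | ∀ i j k, i ≠ j → i ≠ k → j ≠ k → T (i, j, k) = 0}
  add_mem' hS hT i j k h₁ h₂ h₃ := by
    simp [hS i j k h₁ h₂ h₃, hT i j k h₁ h₂ h₃]
  zero_mem' _ _ _ _ _ _ := rfl
  smul_mem' c _ hT i j k h₁ h₂ h₃ := by simp [hT i j k h₁ h₂ h₃]

/-- Subspaces of the space of `r × r` matrices. -/
abbrev MatSubspace (K : Type*) [Field K] (r : ℕ) : Type _ :=
  Submodule K (Matrix (Fin r) (Fin r) K)

/-- The Grassmannian of `d`-dimensional subspaces of the space of `r × r` matrices. -/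
def grassmannian (K : Type*) [Field K] (r d : ℕ) : Set (MatSubspace K r) :=
  {X | Module.finrank K X = d}

/-- Coordinates on the affine space of triples consisting of a `d₁`-tuple, a `d₂`-tuple and a
`d₃`-tuple of `r × r` matrices. -/
abbrev TupleIndex (r d₁ d₂ d₃ : ℕ) : Type :=
  (Fin d₁ × Fin r × Fin r) ⊕ (Fin d₂ × Fin r × Fin r) ⊕ (Fin d₃ × Fin r × Fin r)

/-- The triple of linear spans of the three tuples of matrices with coordinates `x`. -/
def spans {K : Type*} [Field K] {r d₁ d₂ d₃ : ℕ} (x : TupleIndex r d₁ d₂ d₃ → K) :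
    MatSubspace K r × MatSubspace K r × MatSubspace K r :=
  (Submodule.span K (Set.range fun a => Matrix.of fun i j => x (Sum.inl (a, i, j))),
   Submodule.span K (Set.range fun a => Matrix.of fun i j => x (Sum.inr (Sum.inl (a, i, j)))),
   Submodule.span K (Set.range fun a => Matrix.of fun i j => x (Sum.inr (Sum.inr (a, i, j)))))

/-- Zariski-open subsets of the product of the Grassmannians of `d₁`-, `d₂`- and `d₃`-dimensional
subspaces of the space of `r × r` matrices. The product is topologized as the quotient of the
space of triples of bases: a set of triples of subspaces is open if and only if the set of all
triples of bases of its members is open in the affine space of triples of tuples. (A `d`-tuple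
whose span has dimension `d` is a basis of its span.) -/
def IsZariskiOpenTriples {K : Type*} [Field K] (r d₁ d₂ d₃ : ℕ)
    (U : Set (MatSubspace K r × MatSubspace K r × MatSubspace K r)) : Prop :=
  U ⊆ grassmannian K r d₁ ×ˢ grassmannian K r d₂ ×ˢ grassmannian K r d₃ ∧
    IsZariskiOpen {x : TupleIndex r d₁ d₂ d₃ → K | spans x ∈ U}

/-- The property `P` holds for generic subspaces `X₁`, `X₂`, `X₃` of the space of `r × r` matrices
of dimensions `d₁`, `d₂`, `d₃`: it holds on a nonempty Zariski-open set of such triples. -/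
def ForGenericSubspaces (K : Type*) [Field K] (r d₁ d₂ d₃ : ℕ)
    (P : MatSubspace K r → MatSubspace K r → MatSubspace K r → Prop) : Prop :=
  ∃ U : Set (MatSubspace K r × MatSubspace K r × MatSubspace K r),
    U.Nonempty ∧ IsZariskiOpenTriples r d₁ d₂ d₃ U ∧ ∀ X ∈ U, P X.1 X.2.1 X.2.2

end GenericSubrank

open Polynomial in
theorem Derivation.eq_zero_of_isAlgebraic {R A : Type*} [CommRing R] [CommRing A] [IsDomain A]
    [CharZero A] [Algebra R A] {S : Subalgebra R A} (D : Derivation R A A)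
    (hS : ∀ a ∈ S, D a = 0) {b : A} (hb : IsAlgebraic S b) : D b = 0 := by
  let D' : Derivation S A A :=
    { toFun := D
      map_add' := D.map_add
      map_smul' := fun s a => by
        simp [Algebra.smul_def, D.leibniz, hS s.1 s.2]
      map_one_eq_zero' := D.map_one_eq_zero
      leibniz' := D.leibniz }
  change D' b = 0
  have : CharZero S := (algebraMap S A).charZero_iff
    (FaithfulSMul.algebraMap_injective S A) |>.mpr inferInstance
  obtain ⟨p, hp0, hp⟩ := hb
  induction hn : p.natDegree using Nat.strong_induction_on generalizing p with
  | _ n ih =>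
    by_cases hz : p.natDegree = 0
    · rw [Polynomial.eq_C_of_natDegree_eq_zero hz] at hp hp0
      simp only [aeval_C, map_eq_zero_iff _ (FaithfulSMul.algebraMap_injective S A)] at hp
      simp [hp] at hp0
    · have h := D'.map_aeval p b
      rw [hp, map_zero, smul_eq_mul] at h
      rcases mul_eq_zero.mp h.symm with h0 | h0
      · exact ih _ (hn ▸ natDegree_derivative_lt hz) (derivative p)
          (fun h => hz (derivative_eq_zero.mp h)) h0 rfl
      · exact h0

theorem IsTranscendenceBasis.derivation_eq_zero {R A ι : Type*} [CommRing R] [CommRing A]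
    [IsDomain A] [CharZero A] [Nontrivial R] [Algebra R A] {x : ι → A}
    (hx : IsTranscendenceBasis R x) (D : Derivation R A A) (hD : ∀ i, D (x i) = 0) : D = 0 := by
  have halg := hx.isAlgebraic
  refine Derivation.ext fun b => D.eq_zero_of_isAlgebraic (fun a ha => ?_) (halg.isAlgebraic b)
  refine Derivation.eqOn_adjoin (D1 := D) (D2 := 0) ?_ ha
  rintro _ ⟨i, rfl⟩
  exact hD i

theorem MvPolynomial.mkDerivation_eq_sum_pderiv {K σ : Type*} [CommSemiring K] [Fintype σ]
    (w : σ → MvPolynomial σ K) (p : MvPolynomial σ K) :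
    MvPolynomial.mkDerivation K w p = ∑ k, MvPolynomial.pderiv k p * w k := by
  classical
  have hsum : ∀ q, (∑ k, w k • MvPolynomial.pderiv (R := K) k) q =
      ∑ k, MvPolynomial.pderiv k q * w k := fun q => by
    change Derivation.coeFnAddMonoidHom (∑ k, w k • MvPolynomial.pderiv (R := K) k) q = _
    rw [map_sum, Finset.sum_apply]
    exact Finset.sum_congr rfl fun k _ => mul_comm _ _
  rw [← hsum]
  refine congrArg (fun D : Derivation K _ _ => D p) (MvPolynomial.derivation_ext fun i => ?_)
  rw [hsum, MvPolynomial.mkDerivation_X]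
  simp [MvPolynomial.pderiv_X, Pi.single_apply]

theorem exists_derivation_of_algebraicIndependent {K σ τ : Type*} [Field K] [CharZero K]
    [Fintype σ] [Fintype τ] (φ : τ → MvPolynomial σ K) (hφ : AlgebraicIndependent K φ) :
    ∃ s : MvPolynomial σ K, s ≠ 0 ∧ ∀ x, MvPolynomial.eval x s ≠ 0 → ∀ v : τ → K,
      ∃ D : MvPolynomial σ K →+ K, (∀ c, D (MvPolynomial.C c) = 0) ∧
        (∀ p q, D (p * q) = MvPolynomial.eval x p * D q + MvPolynomial.eval x q * D p) ∧
        ∀ i, D (φ i) = v i := by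
  classical
  have : CharZero (MvPolynomial σ K) := (algebraMap K (MvPolynomial σ K)).charZero_iff
    (FaithfulSMul.algebraMap_injective _ _) |>.mp inferInstance
  obtain ⟨t, hst, ht⟩ := exists_isTranscendenceBasis_superset (s := Set.range φ)
    hφ.to_subtype_range
  have hcard := ht.lift_cardinalMk_eq (IsTranscendenceBasis.mvPolynomial σ K)
  obtain ⟨e⟩ := Cardinal.lift_mk_eq'.mp hcard
  let M : Matrix σ σ (MvPolynomial σ K) := fun i k => MvPolynomial.pderiv k ((e.symm i : t) : _)
  have hdet : M.det ≠ 0 := by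
    intro h0
    obtain ⟨w, hw, hMw⟩ := Matrix.exists_mulVec_eq_zero_iff.mpr h0
    apply hw
    funext k
    rw [← MvPolynomial.mkDerivation_X K w k]
    rw [ht.derivation_eq_zero (MvPolynomial.mkDerivation K w) fun q => ?_]
    · rfl
    · have := congrFun hMw (e q)
      rw [MvPolynomial.mkDerivation_eq_sum_pderiv]
      simpa [Matrix.mulVec, dotProduct, M] using this
  refine ⟨M.det, hdet, fun x hx v => ?_⟩
  have hmem : ∀ i, φ i ∈ t := fun i => hst ⟨i, rfl⟩
  let j : τ → σ := fun i => e ⟨φ i, hmem i⟩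
  have hφi : Function.Injective φ := hφ.injective
  have hj : Function.Injective j := fun a b h => hφi (by simpa [j] using h)
  let u : σ → MvPolynomial σ K := fun k =>
    MvPolynomial.C ((MvPolynomial.eval x M.det)⁻¹ * Function.extend j v 0 k)
  let w := M.adjugate.mulVec u
  have hMw : ∀ k, ∑ l, M k l * w l = M.det * u k := by
    intro k
    have : M.mulVec w = M.det • u := by
      simp [w, Matrix.mulVec_mulVec, Matrix.mul_adjugate, Matrix.smul_mulVec]
    simpa [Matrix.mulVec, dotProduct] using congrFun this k
  refine ⟨AddMonoidHom.mk' (fun p => MvPolynomial.eval x (MvPolynomial.mkDerivation K w p))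
    (fun p q => by simp),
    fun c => ?_, fun p q => ?_, fun i => ?_⟩
  · simp [MvPolynomial.derivation_C]
  · simp [Derivation.leibniz]
  · have := hMw (j i)
    simp only [M, j, Equiv.symm_apply_apply] at this
    simp only [AddMonoidHom.mk'_apply, MvPolynomial.mkDerivation_eq_sum_pderiv]
    rw [this]
    have h2 : Function.extend j v 0 (e ⟨φ i, hmem i⟩) = v i := hj.extend_apply v 0 i
    simp only [map_mul, u, MvPolynomial.eval_C, h2, M]
    rw [← mul_assoc, mul_inv_cancel₀ hx, one_mul]

theorem MvPolynomial.IsHomogeneous.aeval_mul_left {R A σ : Type*} [CommSemiring R]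
    [CommSemiring A] [Algebra R A] {p : MvPolynomial σ R} {n : ℕ} (hp : p.IsHomogeneous n)
    (a : A) (z : σ → A) :
    MvPolynomial.aeval (fun i => a * z i) p = a ^ n * MvPolynomial.aeval z p := by
  simp only [MvPolynomial.aeval_def, MvPolynomial.eval₂_eq, Finset.mul_sum]
  refine Finset.sum_congr rfl fun d hd => ?_
  rw [hp.degree_eq_sum_deg_support hd, ← Finset.prod_pow_eq_pow_sum]
  simp only [mul_pow, Finset.prod_mul_distrib]
  ring

open MvPolynomial in
theorem exists_tangent_aeval_ne_zero {K σ : Type*} [Field K] [Infinite K]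
    {f : MvPolynomial σ K} (hf : f ≠ 0) (x₀ : σ → K) :
    ∃ v : σ → K, ∀ y : σ → Polynomial K, (∀ i, (y i).coeff 0 = x₀ i) →
      (∀ i, (y i).coeff 1 = v i) → aeval y f ≠ 0 := by
  classical
  obtain ⟨g, hgf⟩ : ∃ g, g = bind₁ (fun i => X i + C (x₀ i)) f := ⟨_, rfl⟩
  have hfg : bind₁ (fun i => X i - C (x₀ i)) g = f := by
    rw [hgf, bind₁_bind₁]
    simp
  have hg : g ≠ 0 := fun h => hf (by rw [← hfg, h, map_zero])
  have hex : ∃ d, homogeneousComponent d g ≠ 0 := by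
    by_contra! h
    exact hg (by rw [← sum_homogeneousComponent g]; simp [h])
  obtain ⟨d, hd, hmin⟩ : ∃ d, homogeneousComponent d g ≠ 0 ∧
      ∀ e < d, homogeneousComponent e g = 0 :=
    ⟨Nat.find hex, Nat.find_spec hex, fun e he => not_not.mp (Nat.find_min hex he)⟩
  obtain ⟨v, hv⟩ : ∃ v, eval v (homogeneousComponent d g) ≠ 0 := by
    by_contra! h
    exact hd (MvPolynomial.funext fun v => by simp [h v])
  refine ⟨v, fun y h0 h1 hy => hv ?_⟩
  let z : σ → Polynomial K := fun i => (y i).divX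
  have hyz : ∀ i, y i = Polynomial.X * z i + Polynomial.C (x₀ i) := fun i => by
    rw [← h0 i, mul_comm]; exact ((y i).divX_mul_X_add).symm
  have hyg : aeval (fun i => Polynomial.X * z i) g = 0 := by
    rw [← hy, hgf, aeval_bind₁]
    congr 2
    funext i
    simp [hyz, Polynomial.algebraMap_eq]
  have hhom : ∀ e, aeval (fun i => Polynomial.X * z i) (homogeneousComponent e g) =
      Polynomial.X ^ e * aeval z (homogeneousComponent e g) := fun e =>
    (homogeneousComponent_isHomogeneous e g).aeval_mul_left _ _
  have hcoeff : ∀ p : MvPolynomial σ K, (aeval z p).coeff 0 = eval v p := fun p => by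
    have hz : v = fun i => (z i).coeff 0 := by
      funext i; simp [z, h1]
    rw [← Polynomial.constantCoeff_apply, map_aeval, hz]
    simp only [Polynomial.constantCoeff_apply, eval, coe_eval₂Hom]
    congr 1
    ext c
    simp [Polynomial.algebraMap_eq]
  have key : (aeval (fun i => Polynomial.X * z i) g).coeff d =
      (aeval z (homogeneousComponent d g)).coeff 0 := by
    conv_lhs => rw [← sum_homogeneousComponent g]
    rw [map_sum, Polynomial.finsetSum_coeff, Finset.sum_eq_single d]
    · rw [hhom, Polynomial.coeff_X_pow_mul', if_pos le_rfl, Nat.sub_self]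
    · intro e _ he
      rcases lt_or_gt_of_ne he with h | h
      · simp [hmin e h]
      · rw [hhom, Polynomial.coeff_X_pow_mul', if_neg (by omega)]
    · intro h
      rw [homogeneousComponent_eq_zero _ _ (by simpa using h)]
      simp
  rw [← hcoeff, ← key, hyg, Polynomial.coeff_zero]

open MvPolynomial PrimeSpectrum in
theorem exists_ne_zero_vanish_or_dense {K σ τ : Type*} [Field K] [IsAlgClosed K] [Finite σ]
    [Finite τ] (I : Ideal (MvPolynomial (σ ⊕ τ) K)) :
    ∃ f : MvPolynomial σ K, f ≠ 0 ∧
      ((∀ x y, (∀ p ∈ I, eval (Sum.elim x y) p = 0) → eval x f = 0) ∨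
        ∀ x, eval x f ≠ 0 → ∃ y, ∀ p ∈ I, eval (Sum.elim x y) p = 0) := by
  let ψ : MvPolynomial σ K →ₐ[K] (MvPolynomial (σ ⊕ τ) K ⧸ I) :=
    (Ideal.Quotient.mkₐ K I).comp (rename Sum.inl)
  have hev : ∀ (x : σ → K) (y : τ → K) (p : MvPolynomial σ K),
      eval (Sum.elim x y) (rename Sum.inl p) = eval x p := fun x y p => by
    rw [eval_rename, Sum.elim_comp_inl]
  by_cases hinj : Function.Injective ψ
  · have hfp : ψ.toRingHom.FinitePresentation := by
      rw [← RingHom.FinitePresentation.of_finiteType]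
      have : (algebraMap K (MvPolynomial (σ ⊕ τ) K ⧸ I)).FiniteType := by
        rw [RingHom.finiteType_algebraMap]; infer_instance
      rw [← ψ.comp_algebraMap] at this
      exact this.of_comp_finiteType
    obtain ⟨S, hS⟩ := exists_constructibleSetData_iff.mpr (isConstructible_range_comap hfp)
    obtain ⟨P, hP, hPbot⟩ := Ideal.exists_comap_eq_of_mem_minimalPrimes_of_injective
      (f := ψ.toRingHom) hinj ⊥ (by simp [IsDomain.minimalPrimes_eq_singleton_bot])
    have hbot : (⟨⊥, Ideal.isPrime_bot⟩ : PrimeSpectrum (MvPolynomial σ K)) ∈ S.toSet := by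
      rw [hS]
      exact ⟨⟨P, hP⟩, PrimeSpectrum.ext hPbot⟩
    simp only [ConstructibleSetData.toSet, Set.mem_iUnion] at hbot
    obtain ⟨c, hc, hcbot⟩ := hbot
    simp only [BasicConstructibleSetData.toSet, Set.mem_sdiff, mem_zeroLocus, Set.subset_def,
      Set.mem_range, forall_exists_index, forall_apply_eq_imp_iff, Set.mem_singleton_iff,
      forall_eq, SetLike.mem_coe, Ideal.mem_bot] at hcbot
    refine ⟨c.f, hcbot.2, Or.inr fun x hx => ?_⟩
    have hmax : (vanishingIdeal K {x}).IsMaximal :=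
      isMaximal_iff_eq_vanishingIdeal_singleton.mpr ⟨x, rfl⟩
    have hxS : (⟨vanishingIdeal K {x}, hmax.isPrime⟩ : PrimeSpectrum (MvPolynomial σ K)) ∈
        S.toSet := by
      simp only [ConstructibleSetData.toSet, Set.mem_iUnion]
      refine ⟨c, hc, ?_⟩
      simp only [BasicConstructibleSetData.toSet, Set.mem_sdiff, mem_zeroLocus, Set.subset_def,
        Set.mem_range, forall_exists_index, forall_apply_eq_imp_iff, Set.mem_singleton_iff,
        forall_eq, SetLike.mem_coe, hcbot.1, zero_mem, implies_true, true_and]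
      rw [mem_vanishingIdeal_singleton_iff]
      simpa [aeval_eq_eval] using hx
    rw [hS] at hxS
    obtain ⟨Q, hQ⟩ := hxS
    obtain ⟨N, hN, hQN⟩ := Ideal.exists_le_maximal
      (Q.asIdeal.comap (Ideal.Quotient.mk I)) (Ideal.IsPrime.ne_top inferInstance)
    obtain ⟨w, rfl⟩ := isMaximal_iff_eq_vanishingIdeal_singleton.mp hN
    have hzero : ∀ p, Ideal.Quotient.mk I p ∈ Q.asIdeal → eval w p = 0 := fun p hp => by
      have := hQN (Ideal.mem_comap.mpr hp)
      rw [mem_vanishingIdeal_singleton_iff] at this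
      simpa [aeval_eq_eval] using this
    have hwx : w = Sum.elim x (w ∘ Sum.inr) := by
      rw [← Sum.elim_comp_inl_inr w]
      congr 1
      funext i
      have hi : X i - C (x i) ∈ (comap ψ.toRingHom Q).asIdeal := by
        rw [hQ, mem_vanishingIdeal_singleton_iff]
        simp
      have := hzero (rename Sum.inl (X i - C (x i))) hi
      simpa [sub_eq_zero] using this
    refine ⟨w ∘ Sum.inr, fun p hp => ?_⟩
    rw [← hwx]
    exact hzero p (by rw [Ideal.Quotient.eq_zero_iff_mem.mpr hp]; exact zero_mem _)
  · obtain ⟨f, hf, hf0⟩ : ∃ f, ψ f = 0 ∧ f ≠ 0 := by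
      simpa [injective_iff_map_eq_zero] using hinj
    refine ⟨f, hf0, Or.inl fun x y h => ?_⟩
    rw [← hev x y]
    exact h _ (Ideal.Quotient.eq_zero_iff_mem.mp hf)

open Matrix Kronecker in
theorem Matrix.exists_isUnit_det_submatrix_castAdd {K : Type*} [Field K] {r d : ℕ}
    (A : Matrix (Fin r) (Fin (r + d)) K) (hA : LinearIndependent K A.row) :
    ∃ G : Matrix (Fin (r + d)) (Fin (r + d)) K, IsUnit G.det ∧
      G.submatrix (Fin.castAdd d) id = A := by
  classical
  let b := Module.Basis.sumExtend hA
  have : Finite (Fin r ⊕ ↑(Module.Basis.sumExtendIndex hA)) := Module.Finite.finite_basis b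
  have : Finite (Module.Basis.sumExtendIndex hA) :=
    Finite.of_injective (Sum.inr (α := Fin r)) Sum.inr_injective
  have hE : Nat.card (Module.Basis.sumExtendIndex hA) = d := by
    have hcard := Module.finrank_eq_nat_card_basis b
    rw [Nat.card_sum, Module.finrank_fintype_fun_eq_card, Fintype.card_fin, Nat.card_fin] at hcard
    omega
  let e : Fin (r + d) ≃ Fin r ⊕ Module.Basis.sumExtendIndex hA :=
    finSumFinEquiv.symm.trans (Equiv.sumCongr (Equiv.refl _) (Finite.equivFinOfCardEq hE).symm)
  let c := b.reindex e.symm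
  refine ⟨Matrix.of c, ?_, ?_⟩
  · rw [← Matrix.isUnit_iff_isUnit_det, ← Matrix.linearIndependent_rows_iff_isUnit]
    exact c.linearIndependent
  · ext i j
    have : c (Fin.castAdd d i) = A.row i := by
      simp [c, e, b, Module.Basis.sumExtend]
      rfl
    exact congrFun this j

namespace GenericSubrank

open Matrix Kronecker

/-- The action of a triple of matrices on the three legs of a tensor. -/
def legAction {R l₁ l₂ l₃ m₁ m₂ m₃ : Type*} [CommRing R] [Fintype m₁] [Fintype m₂] [Fintype m₃]
    (A : Matrix l₁ m₁ R) (B : Matrix l₂ m₂ R) (C : Matrix l₃ m₃ R) (T : m₁ × m₂ × m₃ → R) :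
    l₁ × l₂ × l₃ → R :=
  (A ⊗ₖ (B ⊗ₖ C)) *ᵥ T

section legAction

variable {R k₁ k₂ k₃ l₁ l₂ l₃ m₁ m₂ m₃ : Type*} [CommRing R]
  [Fintype m₁] [Fintype m₂] [Fintype m₃]

theorem legAction_apply (A : Matrix l₁ m₁ R) (B : Matrix l₂ m₂ R) (C : Matrix l₃ m₃ R)
    (T : m₁ × m₂ × m₃ → R) (i : l₁) (j : l₂) (k : l₃) :
    legAction A B C T (i, j, k) = ∑ a, ∑ b, ∑ c, A i a * B j b * C k c * T (a, b, c) := by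
  simp [legAction, Matrix.mulVec, dotProduct, Fintype.sum_prod_type, mul_assoc]

theorem legAction_legAction [Fintype l₁] [Fintype l₂] [Fintype l₃]
    (A : Matrix k₁ l₁ R) (B : Matrix k₂ l₂ R) (C : Matrix k₃ l₃ R)
    (A' : Matrix l₁ m₁ R) (B' : Matrix l₂ m₂ R) (C' : Matrix l₃ m₃ R) (T : m₁ × m₂ × m₃ → R) :
    legAction A B C (legAction A' B' C' T) = legAction (A * A') (B * B') (C * C') T := by
  simp only [legAction, Matrix.mulVec_mulVec, ← Matrix.mul_kronecker_mul]

theorem legAction_one [DecidableEq m₁] [DecidableEq m₂] [DecidableEq m₃] (T : m₁ × m₂ × m₃ → R) :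
    legAction 1 1 1 T = T := by
  simp [legAction]

theorem legAction_add (A : Matrix l₁ m₁ R) (B : Matrix l₂ m₂ R) (C : Matrix l₃ m₃ R)
    (S T : m₁ × m₂ × m₃ → R) :
    legAction A B C (S + T) = legAction A B C S + legAction A B C T :=
  Matrix.mulVec_add _ _ _

theorem map_legAction {S : Type*} [CommRing S] (φ : R →+* S) (A : Matrix l₁ m₁ R)
    (B : Matrix l₂ m₂ R) (C : Matrix l₃ m₃ R) (T : m₁ × m₂ × m₃ → R) :
    φ ∘ legAction A B C T = legAction (A.map φ) (B.map φ) (C.map φ) (φ ∘ T) := by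
  funext ⟨i, j, k⟩
  simp [legAction_apply]

theorem legAction_leibniz {S : Type*} [CommRing S] (φ : R →+* S) (D : R →+ S)
    (hD : ∀ p q, D (p * q) = φ p * D q + φ q * D p) (A : Matrix l₁ m₁ R)
    (B : Matrix l₂ m₂ R) (C : Matrix l₃ m₃ R) (T : m₁ × m₂ × m₃ → R) :
    D ∘ legAction A B C T = legAction (A.map D) (B.map φ) (C.map φ) (φ ∘ T) +
      legAction (A.map φ) (B.map D) (C.map φ) (φ ∘ T) +
      legAction (A.map φ) (B.map φ) (C.map D) (φ ∘ T) +
      legAction (A.map φ) (B.map φ) (C.map φ) (D ∘ T) := by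
  funext ⟨i, j, k⟩
  simp only [Function.comp_apply, legAction_apply, map_sum, hD, Pi.add_apply, Matrix.map_apply,
    ← Finset.sum_add_distrib, map_mul]
  refine Finset.sum_congr rfl fun a _ => Finset.sum_congr rfl fun b _ =>
    Finset.sum_congr rfl fun c _ => ?_
  ring

end legAction

section restricts

variable {K : Type*} [Field K]

theorem restricts_iff {n₁ n₂ n₃ m₁ m₂ m₃ : ℕ} {S : Tensor K n₁ n₂ n₃} {T : Tensor K m₁ m₂ m₃} :
    Restricts S T ↔ ∃ A B C, legAction A B C T = S := by
  simp only [Restricts, funext_iff, Prod.forall, legAction_apply, eq_comm]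

theorem legAction_unitTensor {l₁ l₂ l₃ : Type*} {r : ℕ} (A : Matrix l₁ (Fin r) K)
    (B : Matrix l₂ (Fin r) K) (C : Matrix l₃ (Fin r) K) (i : l₁) (j : l₂) (k : l₃) :
    legAction A B C (unitTensor K r) (i, j, k) = ∑ a, A i a * B j a * C k a := by
  rw [legAction_apply]
  refine Finset.sum_congr rfl fun a _ => ?_
  rw [Finset.sum_eq_single a (fun b _ hb => ?_) (by simp), Finset.sum_eq_single a]
  · simp [unitTensor]
  · intro c _ hc; simp [unitTensor, hc.symm]
  · simp
  · simp [unitTensor, hb.symm]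

theorem linearIndependent_rows_of_legAction_eq_unitTensor {r n₁ n₂ n₃ : ℕ}
    {A : Matrix (Fin r) (Fin n₁) K} {B : Matrix (Fin r) (Fin n₂) K} {C : Matrix (Fin r) (Fin n₃) K}
    {T : Tensor K n₁ n₂ n₃} (h : legAction A B C T = unitTensor K r) :
    LinearIndependent K A.row ∧ LinearIndependent K B.row ∧ LinearIndependent K C.row := by
  simp only [← Matrix.vecMul_injective_iff]
  refine ⟨?_, ?_, ?_⟩
  · refine (injective_iff_map_eq_zero (Matrix.vecMulLinear A)).mpr fun v hv => funext fun j => ?_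
    have h1 : (Matrix.of fun _ : Fin 1 => v) * A = 0 := by
      ext i a; exact congrFun hv a
    have h2 := congrFun (legAction_legAction (Matrix.of fun _ : Fin 1 => v) 1 1 A B C T) (0, j, j)
    rw [h, h1] at h2
    rw [legAction_unitTensor] at h2
    simpa [legAction_apply, Matrix.one_apply] using h2
  · refine (injective_iff_map_eq_zero (Matrix.vecMulLinear B)).mpr fun v hv => funext fun j => ?_
    have h1 : (Matrix.of fun _ : Fin 1 => v) * B = 0 := by
      ext i a; exact congrFun hv a
    have h2 := congrFun (legAction_legAction 1 (Matrix.of fun _ : Fin 1 => v) 1 A B C T) (j, 0, j)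
    rw [h, h1] at h2
    rw [legAction_unitTensor] at h2
    simpa [legAction_apply, Matrix.one_apply] using h2
  · refine (injective_iff_map_eq_zero (Matrix.vecMulLinear C)).mpr fun v hv => funext fun j => ?_
    have h1 : (Matrix.of fun _ : Fin 1 => v) * C = 0 := by
      ext i a; exact congrFun hv a
    have h2 := congrFun (legAction_legAction 1 1 (Matrix.of fun _ : Fin 1 => v) A B C T) (j, j, 0)
    rw [h, h1] at h2
    rw [legAction_unitTensor] at h2
    simpa [legAction_apply, Matrix.one_apply] using h2

theorem Restricts.le {r n₁ n₂ n₃ : ℕ} {T : Tensor K n₁ n₂ n₃}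
    (h : Restricts (unitTensor K r) T) : r ≤ n₁ := by
  obtain ⟨A, B, C, h⟩ := restricts_iff.mp h
  simpa using (linearIndependent_rows_of_legAction_eq_unitTensor h).1.fintype_card_le_finrank

theorem Restricts.mono {r q n₁ n₂ n₃ : ℕ} {T : Tensor K n₁ n₂ n₃}
    (h : Restricts (unitTensor K q) T) (hrq : r ≤ q) : Restricts (unitTensor K r) T := by
  obtain ⟨A, B, C, h⟩ := h
  refine ⟨A.submatrix (Fin.castLE hrq) id, B.submatrix (Fin.castLE hrq) id,
    C.submatrix (Fin.castLE hrq) id, fun i j k => ?_⟩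
  simp [← h, unitTensor]

theorem restricts_unitTensor_zero {n₁ n₂ n₃ : ℕ} (T : Tensor K n₁ n₂ n₃) :
    Restricts (unitTensor K 0) T :=
  ⟨0, 0, 0, fun i => i.elim0⟩

theorem le_subrank_iff {r n₁ n₂ n₃ : ℕ} {T : Tensor K n₁ n₂ n₃} :
    r ≤ subrank T ↔ Restricts (unitTensor K r) T := by
  have hb : BddAbove {r : ℕ | Restricts (unitTensor K r) T} := ⟨n₁, fun _ h => Restricts.le h⟩
  exact ⟨fun h => Restricts.mono (Nat.sSup_mem ⟨0, restricts_unitTensor_zero T⟩ hb) h,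
    fun h => le_csSup hb h⟩

/-- The leading `r × r × r` block of a tensor. -/
def corner {r d₁ d₂ d₃ : ℕ} (T : Tensor K (r + d₁) (r + d₂) (r + d₃)) : Tensor K r r r :=
  fun p => T (Fin.castAdd d₁ p.1, Fin.castAdd d₂ p.2.1, Fin.castAdd d₃ p.2.2)

theorem restricts_legAction_of_corner_eq {r d₁ d₂ d₃ : ℕ}
    {G₁ : Matrix (Fin (r + d₁)) (Fin (r + d₁)) K} {G₂ : Matrix (Fin (r + d₂)) (Fin (r + d₂)) K}
    {G₃ : Matrix (Fin (r + d₃)) (Fin (r + d₃)) K} (h₁ : IsUnit G₁.det) (h₂ : IsUnit G₂.det)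
    (h₃ : IsUnit G₃.det) {Y : Tensor K (r + d₁) (r + d₂) (r + d₃)}
    (hY : corner Y = unitTensor K r) :
    Restricts (unitTensor K r) (legAction G₁ G₂ G₃ Y) := by
  refine restricts_iff.mpr ⟨G₁⁻¹.submatrix (Fin.castAdd d₁) id, G₂⁻¹.submatrix (Fin.castAdd d₂) id,
    G₃⁻¹.submatrix (Fin.castAdd d₃) id, ?_⟩
  change corner (legAction G₁⁻¹ G₂⁻¹ G₃⁻¹ (legAction G₁ G₂ G₃ Y)) = _
  rw [legAction_legAction, Matrix.nonsing_inv_mul _ h₁, Matrix.nonsing_inv_mul _ h₂,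
    Matrix.nonsing_inv_mul _ h₃, legAction_one, hY]

theorem Restricts.exists_legAction_eq {r d₁ d₂ d₃ : ℕ} {T : Tensor K (r + d₁) (r + d₂) (r + d₃)}
    (h : Restricts (unitTensor K r) T) :
    ∃ (G₁ : Matrix (Fin (r + d₁)) (Fin (r + d₁)) K) (G₂ : Matrix (Fin (r + d₂)) (Fin (r + d₂)) K)
      (G₃ : Matrix (Fin (r + d₃)) (Fin (r + d₃)) K) (Y : Tensor K (r + d₁) (r + d₂) (r + d₃)),
      corner Y = unitTensor K r ∧ T = legAction G₁ G₂ G₃ Y := by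
  obtain ⟨A, B, C, h⟩ := restricts_iff.mp h
  obtain ⟨hA, hB, hC⟩ := linearIndependent_rows_of_legAction_eq_unitTensor h
  obtain ⟨G₁, h₁, rfl⟩ := A.exists_isUnit_det_submatrix_castAdd hA
  obtain ⟨G₂, h₂, rfl⟩ := B.exists_isUnit_det_submatrix_castAdd hB
  obtain ⟨G₃, h₃, rfl⟩ := C.exists_isUnit_det_submatrix_castAdd hC
  refine ⟨G₁⁻¹, G₂⁻¹, G₃⁻¹, legAction G₁ G₂ G₃ T, h, ?_⟩
  rw [legAction_legAction, Matrix.nonsing_inv_mul _ h₁, Matrix.nonsing_inv_mul _ h₂,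
    Matrix.nonsing_inv_mul _ h₃, legAction_one]

end restricts

end GenericSubrank

theorem Matrix.mulVec_surjective_iff_exists_det_submatrix_ne_zero {K ι κ : Type*} [Field K]
    [Fintype ι] [DecidableEq ι] [Fintype κ] (M : Matrix ι κ K) :
    Function.Surjective M.mulVec ↔ ∃ e : ι → κ, (M.submatrix id e).det ≠ 0 := by
  classical
  constructor
  · intro h
    have hspan : Submodule.span K (Set.range M.col) = ⊤ := by
      rw [← Matrix.range_mulVecLin, LinearMap.range_eq_top]
      exact h
    obtain ⟨κ', a, ha, hs, hli⟩ := exists_linearIndependent' K M.col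
    rw [hspan] at hs
    let b : Module.Basis κ' K (ι → K) := Module.Basis.mk hli hs.ge
    have : Finite κ' := Finite.of_injective a ha
    have : Fintype κ' := Fintype.ofFinite κ'
    have hc : Fintype.card ι = Fintype.card κ' := by
      rw [← Module.finrank_eq_card_basis b, Module.finrank_fintype_fun_eq_card]
    let e := Fintype.equivOfCardEq hc
    refine ⟨a ∘ e, IsUnit.ne_zero ?_⟩
    rw [← Matrix.isUnit_iff_isUnit_det, ← Matrix.linearIndependent_cols_iff_isUnit]
    exact hli.comp e e.injective
  · rintro ⟨e, he⟩ v
    refine ⟨∑ i, Pi.single (e i) (((M.submatrix id e)⁻¹.mulVec v) i), ?_⟩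
    have h1 : (M.submatrix id e).mulVec ((M.submatrix id e)⁻¹.mulVec v) = v := by
      rw [Matrix.mulVec_mulVec, Matrix.mul_nonsing_inv _ (isUnit_iff_ne_zero.mpr he),
        Matrix.one_mulVec]
    rw [← Matrix.mulVecLin_apply, map_sum]
    conv_rhs => rw [← h1]
    funext i
    simp [Matrix.mulVec, dotProduct, Finset.sum_apply]

theorem Matrix.mulVec_surjective_iff_linearIndependent_row {K ι κ : Type*} [Field K]
    [Fintype ι] [Fintype κ] (M : Matrix ι κ K) :
    Function.Surjective M.mulVec ↔ LinearIndependent K M.row := by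
  rw [linearIndependent_iff_card_eq_finrank_span, Set.finrank, ← Matrix.rank_eq_finrank_span_row,
    Matrix.rank, ← Module.finrank_fintype_fun_eq_card (R := K) (η := ι), eq_comm,
    ← Submodule.eq_top_iff_finrank_eq, LinearMap.range_eq_top]
  rfl

namespace GenericSubrank

section ZariskiOpen

open MvPolynomial

variable {K σ : Type*} [Field K]

theorem isZariskiOpen_eval_ne_zero (f : MvPolynomial σ K) :
    IsZariskiOpen {x | eval x f ≠ 0} :=
  ⟨{f}, by ext; simp⟩

theorem IsZariskiOpen.exists_of_nonempty {U : Set (σ → K)} (hU : IsZariskiOpen U)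
    (hne : U.Nonempty) : ∃ f : MvPolynomial σ K, f ≠ 0 ∧ ∀ x, eval x f ≠ 0 → x ∈ U := by
  obtain ⟨F, hF⟩ := hU
  obtain ⟨x, hx⟩ := hne
  have hx' : ¬ ∀ p ∈ F, eval x p = 0 := fun h => by
    have : x ∈ Uᶜ := by rw [hF]; exact h
    exact this hx
  push Not at hx'
  obtain ⟨p, hp, hpx⟩ := hx'
  refine ⟨p, fun h => hpx (by simp [h]), fun y hy => ?_⟩
  by_contra hyU
  have : y ∈ Uᶜ := hyU
  rw [hF] at this
  exact hy (this p hp)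

theorem IsZariskiOpen.inter {U V : Set (σ → K)} (hU : IsZariskiOpen U) (hV : IsZariskiOpen V) :
    IsZariskiOpen (U ∩ V) := by
  classical
  obtain ⟨F, hF⟩ := hU
  obtain ⟨G, hG⟩ := hV
  refine ⟨(F ×ˢ G).image fun p => p.1 * p.2, ?_⟩
  rw [Set.compl_inter, hF, hG]
  ext x
  simp only [Set.mem_union, Set.mem_ofPred_eq, Finset.mem_image, Finset.mem_product, Prod.exists,
    forall_exists_index, and_imp]
  constructor
  · rintro (h | h) _ p q hp hq rfl
    · simp [h p hp]
    · simp [h q hq]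
  · intro h
    by_contra! hc
    obtain ⟨⟨p, hp, hpx⟩, q, hq, hqx⟩ := hc
    have := h _ p q hp hq rfl
    rw [map_mul] at this
    exact (mul_ne_zero hpx hqx) this

theorem exists_eval_ne_zero [Infinite K] {f : MvPolynomial σ K} (hf : f ≠ 0) :
    ∃ x, eval x f ≠ 0 := by
  by_contra! h
  exact hf (MvPolynomial.funext fun v => by simp [h v])

theorem IsZariskiOpen.inter_nonempty [Infinite K] {U V : Set (σ → K)} (hU : IsZariskiOpen U)
    (hV : IsZariskiOpen V) (hU' : U.Nonempty) (hV' : V.Nonempty) : (U ∩ V).Nonempty := by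
  obtain ⟨f, hf, hfU⟩ := hU.exists_of_nonempty hU'
  obtain ⟨g, hg, hgV⟩ := hV.exists_of_nonempty hV'
  obtain ⟨x, hx⟩ := exists_eval_ne_zero (mul_ne_zero hf hg)
  rw [map_mul] at hx
  exact ⟨x, hfU x (left_ne_zero_of_mul hx), hgV x (right_ne_zero_of_mul hx)⟩

theorem isZariskiOpen_mulVec_surjective {ι κ : Type*} [Fintype ι] [Fintype κ]
    (P : Matrix ι κ (MvPolynomial σ K)) :
    IsZariskiOpen {x | Function.Surjective (P.map (eval x)).mulVec} := by
  classical
  refine ⟨Finset.univ.image fun e : ι → κ => (P.submatrix id e).det, ?_⟩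
  ext x
  simp only [Matrix.mulVec_surjective_iff_exists_det_submatrix_ne_zero, Set.mem_compl_iff,
    Set.mem_ofPred_eq, Finset.mem_image, Finset.mem_univ, true_and, forall_exists_index,
    forall_apply_eq_imp_iff, not_exists, not_not]
  refine forall_congr' fun e => ?_
  rw [RingHom.map_det]
  rfl

end ZariskiOpen

section generic

open MvPolynomial

variable (K : Type*) [Field K] [IsAlgClosed K] (n₁ n₂ n₃ : ℕ)

theorem exists_ne_zero_restricts_or_not_restricts (r : ℕ) :
    ∃ f : MvPolynomial (Fin n₁ × Fin n₂ × Fin n₃) K, f ≠ 0 ∧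
      ((∀ T : Tensor K n₁ n₂ n₃, Restricts (unitTensor K r) T → eval T f = 0) ∨
        ∀ T : Tensor K n₁ n₂ n₃, eval T f ≠ 0 → Restricts (unitTensor K r) T) := by
  let τ := (Fin r × Fin n₁) ⊕ (Fin r × Fin n₂) ⊕ (Fin r × Fin n₃)
  let R := MvPolynomial ((Fin n₁ × Fin n₂ × Fin n₃) ⊕ τ) K
  let A : Matrix (Fin r) (Fin n₁) R := fun i a => X (Sum.inr (Sum.inl (i, a)))
  let B : Matrix (Fin r) (Fin n₂) R := fun i a => X (Sum.inr (Sum.inr (Sum.inl (i, a))))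
  let C' : Matrix (Fin r) (Fin n₃) R := fun i a => X (Sum.inr (Sum.inr (Sum.inr (i, a))))
  let I : Ideal R := Ideal.span (Set.range fun p =>
    legAction A B C' (fun q => X (Sum.inl q)) p - C (unitTensor K r p))
  have hI : ∀ (T : Tensor K n₁ n₂ n₃) (y : τ → K), (∀ p ∈ I, eval (Sum.elim T y) p = 0) ↔
      legAction (fun i a => y (Sum.inl (i, a))) (fun i a => y (Sum.inr (Sum.inl (i, a))))
        (fun i a => y (Sum.inr (Sum.inr (i, a)))) T = unitTensor K r := fun T y => by
    have h1 : (∀ p ∈ I, eval (Sum.elim T y) p = 0) ↔ I ≤ RingHom.ker (eval (Sum.elim T y)) :=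
      Iff.rfl
    have h2 := map_legAction (eval (Sum.elim T y)) A B C' (fun q => X (Sum.inl q))
    have h3 : ∀ p, eval (Sum.elim T y) (legAction A B C' (fun q => X (Sum.inl q)) p) =
        legAction (fun i a => y (Sum.inl (i, a))) (fun i a => y (Sum.inr (Sum.inl (i, a))))
          (fun i a => y (Sum.inr (Sum.inr (i, a)))) T p := fun p => by
      refine (congrFun h2 p).trans ?_
      congr 1 <;> ext <;> exact eval_X _
    rw [h1, Ideal.span_le, Set.range_subset_iff, _root_.funext_iff]
    refine forall_congr' fun p => ?_
    rw [SetLike.mem_coe, RingHom.mem_ker, map_sub, h3, eval_C, sub_eq_zero]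
  obtain ⟨f, hf, h⟩ := exists_ne_zero_vanish_or_dense I
  refine ⟨f, hf, h.imp (fun h T hT => ?_) fun h T hT => ?_⟩
  · obtain ⟨A', B', C'', hABC⟩ := restricts_iff.mp hT
    exact h T (Sum.elim (fun p => A' p.1 p.2) (Sum.elim (fun p => B' p.1 p.2)
      (fun p => C'' p.1 p.2))) ((hI _ _).mpr hABC)
  · obtain ⟨y, hy⟩ := h T hT
    exact restricts_iff.mpr ⟨_, _, _, (hI _ _).mp hy⟩

theorem isGenericSubrank_genericSubrank :
    IsGenericSubrank K n₁ n₂ n₃ (genericSubrank K n₁ n₂ n₃) := by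
  classical
  have : Infinite K := IsAlgClosed.instInfinite
  suffices h : ∃ q, IsGenericSubrank K n₁ n₂ n₃ q from Nat.sInf_mem h
  have hex : ∃ q, ¬ ∃ f : MvPolynomial (Fin n₁ × Fin n₂ × Fin n₃) K, f ≠ 0 ∧
      ∀ T : Tensor K n₁ n₂ n₃, eval T f ≠ 0 → Restricts (unitTensor K q) T := by
    refine ⟨n₁ + 1, ?_⟩
    rintro ⟨f, hf, h⟩
    obtain ⟨T, hT⟩ := exists_eval_ne_zero hf
    exact absurd (h T hT).le (by omega)
  obtain ⟨q, hq⟩ : ∃ q, q + 1 = Nat.find hex := by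
    refine ⟨Nat.find hex - 1, Nat.sub_add_cancel (Nat.pos_of_ne_zero fun h0 => ?_)⟩
    have := Nat.find_spec hex
    rw [h0] at this
    exact this ⟨1, one_ne_zero, fun T _ => restricts_unitTensor_zero T⟩
  obtain ⟨f, hf, hfq⟩ := not_not.mp (Nat.find_min hex (m := q) (by omega))
  have hnot := Nat.find_spec hex
  rw [← hq] at hnot
  obtain ⟨g, hg, hgq | hgq⟩ := exists_ne_zero_restricts_or_not_restricts K n₁ n₂ n₃ (q + 1)
  · obtain ⟨T₀, hT₀⟩ := exists_eval_ne_zero (mul_ne_zero hf hg)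
    refine ⟨q, {T | eval T (f * g) ≠ 0}, ⟨T₀, hT₀⟩, isZariskiOpen_eval_ne_zero _, fun T hT => ?_⟩
    rw [Set.mem_ofPred_eq, map_mul] at hT
    refine le_antisymm (not_lt.mp fun h => ?_)
      (le_subrank_iff.mpr (hfq T (left_ne_zero_of_mul hT)))
    exact right_ne_zero_of_mul hT (hgq T (le_subrank_iff.mp h))
  · exact absurd ⟨g, hg, hgq⟩ hnot

/-- `r` is at most the generic subrank if and only if all tensors in some nonempty principal open
set restrict to the diagonal tensor of size `r`. -/
theorem le_genericSubrank_iff {r : ℕ} :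
    r ≤ genericSubrank K n₁ n₂ n₃ ↔ ∃ f : MvPolynomial (Fin n₁ × Fin n₂ × Fin n₃) K, f ≠ 0 ∧
      ∀ T : Tensor K n₁ n₂ n₃, eval T f ≠ 0 → Restricts (unitTensor K r) T := by
  have : Infinite K := IsAlgClosed.instInfinite
  obtain ⟨U, hne, hU, hUq⟩ := isGenericSubrank_genericSubrank K n₁ n₂ n₃
  obtain ⟨g, hg, hgU⟩ := hU.exists_of_nonempty hne
  constructor
  · exact fun hr => ⟨g, hg, fun T hT => le_subrank_iff.mp (hUq T (hgU T hT) ▸ hr)⟩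
  · rintro ⟨f, hf, h⟩
    obtain ⟨T, hT⟩ := exists_eval_ne_zero (mul_ne_zero hf hg)
    rw [map_mul] at hT
    rw [← hUq T (hgU T (right_ne_zero_of_mul hT))]
    exact le_subrank_iff.mpr (h T (left_ne_zero_of_mul hT))

end generic

/-- The matrix of the linear map that sends coefficients of three tensors, whose slices are linear
combinations of the matrices in the three tuples with coordinates `x`, and a tensor in
`distinctVanishing` to the sum of the four tensors. -/
def legSumMatrix {R : Type*} [CommRing R] {r d₁ d₂ d₃ : ℕ} (x : TupleIndex r d₁ d₂ d₃ → R) :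
    Matrix (Fin r × Fin r × Fin r)
      ((Fin r × Fin d₁) ⊕ (Fin r × Fin d₂) ⊕ (Fin r × Fin d₃) ⊕ (Fin r × Fin r × Fin r)) R :=
  fun p => Sum.elim (fun q => if p.1 = q.1 then x (Sum.inl (q.2, p.2.1, p.2.2)) else 0)
    (Sum.elim (fun q => if p.2.1 = q.1 then x (Sum.inr (Sum.inl (q.2, p.1, p.2.2))) else 0)
      (Sum.elim (fun q => if p.2.2 = q.1 then x (Sum.inr (Sum.inr (q.2, p.1, p.2.1))) else 0)
        fun q => if p = q then
          (if p.1 ≠ p.2.1 ∧ p.1 ≠ p.2.2 ∧ p.2.1 ≠ p.2.2 then 0 else 1) else 0))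

theorem legSumMatrix_map {R S : Type*} [CommRing R] [CommRing S] (φ : R →+* S) {r d₁ d₂ d₃ : ℕ}
    (x : TupleIndex r d₁ d₂ d₃ → R) : (legSumMatrix x).map φ = legSumMatrix (φ ∘ x) := by
  ext p (q | q | q | q) <;>
    simp [legSumMatrix, apply_ite φ]

variable {K : Type*} [Field K] {r d₁ d₂ d₃ : ℕ}

theorem legSumMatrix_mulVec (x : TupleIndex r d₁ d₂ d₃ → K)
    (u : (Fin r × Fin d₁) ⊕ (Fin r × Fin d₂) ⊕ (Fin r × Fin d₃) ⊕ (Fin r × Fin r × Fin r) → K)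
    (i j k : Fin r) :
    (legSumMatrix x).mulVec u (i, j, k) = ∑ a, u (Sum.inl (i, a)) * x (Sum.inl (a, j, k)) +
      ∑ b, u (Sum.inr (Sum.inl (j, b))) * x (Sum.inr (Sum.inl (b, i, k))) +
      ∑ c, u (Sum.inr (Sum.inr (Sum.inl (k, c)))) * x (Sum.inr (Sum.inr (c, i, j))) +
      if i ≠ j ∧ i ≠ k ∧ j ≠ k then 0 else u (Sum.inr (Sum.inr (Sum.inr (i, j, k)))) := by
  simp only [Matrix.mulVec, dotProduct, Fintype.sum_sum_type, legSumMatrix, Sum.elim_inl,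
    Sum.elim_inr, ite_mul, zero_mul, one_mul, Finset.sum_ite_eq, Finset.mem_univ, if_true]
  rw [Fintype.sum_prod_type, Fintype.sum_prod_type, Fintype.sum_prod_type]
  simp [mul_comm, add_assoc]

theorem tensorLeg_sup_eq_top_iff (x : TupleIndex r d₁ d₂ d₃ → K) :
    tensorLeg₁ r (spans x).1 ⊔ tensorLeg₂ r (spans x).2.1 ⊔ tensorLeg₃ r (spans x).2.2 ⊔
      distinctVanishing K r = ⊤ ↔ Function.Surjective (legSumMatrix x).mulVec := by
  constructor
  · intro h v
    have hv : v ∈ tensorLeg₁ r (spans x).1 ⊔ tensorLeg₂ r (spans x).2.1 ⊔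
        tensorLeg₃ r (spans x).2.2 ⊔ distinctVanishing K r := h ▸ Submodule.mem_top
    obtain ⟨s', hs', w, hw, rfl⟩ := Submodule.mem_sup.mp hv
    obtain ⟨s, hs, t₃, h₃, rfl⟩ := Submodule.mem_sup.mp hs'
    obtain ⟨t₁, h₁, t₂, h₂, rfl⟩ := Submodule.mem_sup.mp hs
    choose c₁ hc₁ using fun i => (Submodule.mem_span_range_iff_exists_fun K).mp (h₁ i)
    choose c₂ hc₂ using fun i => (Submodule.mem_span_range_iff_exists_fun K).mp (h₂ i)
    choose c₃ hc₃ using fun i => (Submodule.mem_span_range_iff_exists_fun K).mp (h₃ i)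
    refine ⟨Sum.elim (fun q => c₁ q.1 q.2) (Sum.elim (fun q => c₂ q.1 q.2)
      (Sum.elim (fun q => c₃ q.1 q.2) w)), ?_⟩
    funext ⟨i, j, k⟩
    rw [legSumMatrix_mulVec]
    have e₁ := congrFun (congrFun (hc₁ i) j) k
    have e₂ := congrFun (congrFun (hc₂ j) i) k
    have e₃ := congrFun (congrFun (hc₃ k) i) j
    simp only [Matrix.sum_apply, Matrix.smul_apply, Matrix.of_apply, smul_eq_mul] at e₁ e₂ e₃
    simp only [Sum.elim_inl, Sum.elim_inr, e₁, e₂, e₃, Pi.add_apply]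
    congr 1
    split_ifs with hd
    · exact (hw i j k hd.1 hd.2.1 hd.2.2).symm
    · rfl
  · intro h
    rw [eq_top_iff]
    intro v _
    obtain ⟨u, rfl⟩ := h v
    have : (legSumMatrix x).mulVec u =
        (fun p : Fin r × Fin r × Fin r =>
          ∑ a, u (Sum.inl (p.1, a)) * x (Sum.inl (a, p.2.1, p.2.2))) +
        (fun p => ∑ b, u (Sum.inr (Sum.inl (p.2.1, b))) *
          x (Sum.inr (Sum.inl (b, p.1, p.2.2)))) +
        (fun p => ∑ c, u (Sum.inr (Sum.inr (Sum.inl (p.2.2, c)))) *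
          x (Sum.inr (Sum.inr (c, p.1, p.2.1)))) +
        (fun p => if p.1 ≠ p.2.1 ∧ p.1 ≠ p.2.2 ∧ p.2.1 ≠ p.2.2 then 0 else
          u (Sum.inr (Sum.inr (Sum.inr p)))) := by
      funext ⟨i, j, k⟩
      rw [legSumMatrix_mulVec]
      rfl
    rw [this]
    refine Submodule.add_mem_sup (Submodule.add_mem_sup (Submodule.add_mem_sup ?_ ?_) ?_) ?_
    · exact fun i => (Submodule.mem_span_range_iff_exists_fun K).mpr
        ⟨fun a => u (Sum.inl (i, a)), by ext j k; simp [Matrix.sum_apply]⟩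
    · exact fun i => (Submodule.mem_span_range_iff_exists_fun K).mpr
        ⟨fun a => u (Sum.inr (Sum.inl (i, a))), by ext j k; simp [Matrix.sum_apply]⟩
    · exact fun i => (Submodule.mem_span_range_iff_exists_fun K).mpr
        ⟨fun a => u (Sum.inr (Sum.inr (Sum.inl (i, a)))), by ext j k; simp [Matrix.sum_apply]⟩
    · exact fun i j k h₁ h₂ h₃ => if_pos ⟨h₁, h₂, h₃⟩

/-- The entries of a tensor with two indices in the leading block and one index outside. -/
def borderSlices (Y : Tensor K (r + d₁) (r + d₂) (r + d₃)) : TupleIndex r d₁ d₂ d₃ → K :=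
  Sum.elim (fun q => Y (Fin.natAdd r q.1, Fin.castAdd d₂ q.2.1, Fin.castAdd d₃ q.2.2))
    (Sum.elim (fun q => Y (Fin.castAdd d₁ q.2.1, Fin.natAdd r q.1, Fin.castAdd d₃ q.2.2))
      fun q => Y (Fin.castAdd d₁ q.2.1, Fin.castAdd d₂ q.2.2, Fin.natAdd r q.1))

/-- A tensor with leading block the diagonal tensor and prescribed adjacent slices. -/
def borderTensor (x : TupleIndex r d₁ d₂ d₃ → K) : Tensor K (r + d₁) (r + d₂) (r + d₃) :=
  fun p => Fin.addCases
    (fun i => Fin.addCases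
      (fun j => Fin.addCases (fun k => unitTensor K r (i, j, k))
        (fun c => x (Sum.inr (Sum.inr (c, i, j)))) p.2.2)
      (fun b => Fin.addCases (fun k => x (Sum.inr (Sum.inl (b, i, k)))) (fun _ => 0) p.2.2) p.2.1)
    (fun a => Fin.addCases
      (fun j => Fin.addCases (fun k => x (Sum.inl (a, j, k))) (fun _ => 0) p.2.2)
      (fun _ => 0) p.2.1) p.1

theorem corner_borderTensor (x : TupleIndex r d₁ d₂ d₃ → K) :
    corner (borderTensor x) = unitTensor K r := by
  funext ⟨i, j, k⟩
  simp [corner, borderTensor]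

theorem borderSlices_borderTensor (x : TupleIndex r d₁ d₂ d₃ → K) :
    borderSlices (borderTensor x) = x := by
  funext q
  rcases q with q | q | q <;> simp [borderSlices, borderTensor]

/-- The leading block of the derivative of the leg action on `Y` when the leading block of `Y` is
the diagonal tensor. -/
theorem sum_leg_eq_of_corner_eq {Y : Tensor K (r + d₁) (r + d₂) (r + d₃)}
    (hY : corner Y = unitTensor K r) (N₁ : Matrix (Fin r) (Fin (r + d₁)) K)
    (N₂ : Matrix (Fin r) (Fin (r + d₂)) K) (N₃ : Matrix (Fin r) (Fin (r + d₃)) K)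
    (i j k : Fin r) :
    ∑ a, N₁ i a * Y (a, Fin.castAdd d₂ j, Fin.castAdd d₃ k) +
      ∑ b, N₂ j b * Y (Fin.castAdd d₁ i, b, Fin.castAdd d₃ k) +
      ∑ c, N₃ k c * Y (Fin.castAdd d₁ i, Fin.castAdd d₂ j, c) =
    (if j = k then N₁ i (Fin.castAdd d₁ j) else 0) +
      (if i = k then N₂ j (Fin.castAdd d₂ i) else 0) +
      (if i = j then N₃ k (Fin.castAdd d₃ i) else 0) +
      (∑ a, N₁ i (Fin.natAdd r a) * borderSlices Y (Sum.inl (a, j, k)) +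
      ∑ b, N₂ j (Fin.natAdd r b) * borderSlices Y (Sum.inr (Sum.inl (b, i, k))) +
      ∑ c, N₃ k (Fin.natAdd r c) * borderSlices Y (Sum.inr (Sum.inr (c, i, j)))) := by
  have hY' : ∀ i j k, Y (Fin.castAdd d₁ i, Fin.castAdd d₂ j, Fin.castAdd d₃ k) =
      if i = j ∧ j = k then 1 else 0 := fun i j k => congrFun hY (i, j, k)
  have e₁ : ∑ a, N₁ i (Fin.castAdd d₁ a) * (if a = j ∧ j = k then 1 else 0) =
      if j = k then N₁ i (Fin.castAdd d₁ j) else 0 := by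
    by_cases h : j = k <;> simp [h]
  have e₂ : ∑ b, N₂ j (Fin.castAdd d₂ b) * (if i = b ∧ b = k then 1 else 0) =
      if i = k then N₂ j (Fin.castAdd d₂ i) else 0 := by
    rw [Finset.sum_eq_single i] <;> simp +contextual [eq_comm]
  have e₃ : ∑ c, N₃ k (Fin.castAdd d₃ c) * (if i = j ∧ j = c then 1 else 0) =
      if i = j then N₃ k (Fin.castAdd d₃ i) else 0 := by
    by_cases h : i = j <;> simp [h]
  simp only [Fin.sum_univ_add, hY', e₁, e₂, e₃, borderSlices, Sum.elim_inl, Sum.elim_inr]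
  ring

theorem legSumMatrix_surjective_iff {Y : Tensor K (r + d₁) (r + d₂) (r + d₃)}
    (hY : corner Y = unitTensor K r) :
    Function.Surjective (legSumMatrix (borderSlices Y)).mulVec ↔
      ∀ v : Tensor K r r r, ∃ (N₁ : Matrix (Fin r) (Fin (r + d₁)) K)
        (N₂ : Matrix (Fin r) (Fin (r + d₂)) K) (N₃ : Matrix (Fin r) (Fin (r + d₃)) K),
        ∀ i j k, ∑ a, N₁ i a * Y (a, Fin.castAdd d₂ j, Fin.castAdd d₃ k) +
          ∑ b, N₂ j b * Y (Fin.castAdd d₁ i, b, Fin.castAdd d₃ k) +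
          ∑ c, N₃ k c * Y (Fin.castAdd d₁ i, Fin.castAdd d₂ j, c) = v (i, j, k) := by
  simp only [sum_leg_eq_of_corner_eq hY]
  refine forall_congr' fun v => ⟨?_, ?_⟩
  · rintro ⟨u, rfl⟩
    refine ⟨fun i => Fin.addCases (fun j => u (Sum.inr (Sum.inr (Sum.inr (i, j, j)))))
        (fun a => u (Sum.inl (i, a))),
      fun j => Fin.addCases
        (fun i => if i = j then 0 else u (Sum.inr (Sum.inr (Sum.inr (i, j, i)))))
        (fun b => u (Sum.inr (Sum.inl (j, b)))),
      fun k => Fin.addCases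
        (fun i => if i = k then 0 else u (Sum.inr (Sum.inr (Sum.inr (i, i, k)))))
        (fun c => u (Sum.inr (Sum.inr (Sum.inl (k, c))))), fun i j k => ?_⟩
    rw [legSumMatrix_mulVec]
    simp only [Fin.addCases_left, Fin.addCases_right]
    rw [add_comm]
    congr 1
    by_cases h₁ : i = j <;> by_cases h₂ : i = k <;> by_cases h₃ : j = k <;> simp_all
  · rintro ⟨N₁, N₂, N₃, h⟩
    refine ⟨Sum.elim (fun q => N₁ q.1 (Fin.natAdd r q.2))
      (Sum.elim (fun q => N₂ q.1 (Fin.natAdd r q.2))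
      (Sum.elim (fun q => N₃ q.1 (Fin.natAdd r q.2))
        fun q => (if q.2.1 = q.2.2 then N₁ q.1 (Fin.castAdd d₁ q.2.1) else 0) +
          (if q.1 = q.2.2 then N₂ q.2.1 (Fin.castAdd d₂ q.1) else 0) +
          (if q.1 = q.2.1 then N₃ q.2.2 (Fin.castAdd d₃ q.1) else 0))), ?_⟩
    funext ⟨i, j, k⟩
    rw [legSumMatrix_mulVec, ← h i j k]
    simp only [Sum.elim_inl, Sum.elim_inr]
    rw [add_comm]
    congr 1
    split_ifs <;> simp_all

end GenericSubrank

theorem AlgHom.map_aeval_eq_eval {K A σ : Type*} [CommSemiring K] [CommSemiring A] [Algebra K A]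
    (φ : A →ₐ[K] K) (y : σ → A) (f : MvPolynomial σ K) :
    φ (MvPolynomial.aeval y f) = MvPolynomial.eval (φ ∘ y) f := by
  change (φ.comp (MvPolynomial.aeval y)) f = _
  rw [MvPolynomial.comp_aeval]
  rfl

namespace GenericSubrank

section legAction

variable {R l m n : Type*} [CommRing R] [Fintype l] [Fintype m] [Fintype n]

theorem legAction_one_one [DecidableEq m] [DecidableEq n] (M : Matrix l l R)
    (Y : l × m × n → R) (i : l) (j : m) (k : n) :
    legAction M 1 1 Y (i, j, k) = ∑ a, M i a * Y (a, j, k) := by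
  simp [legAction_apply, Matrix.one_apply]

theorem legAction_one_left_right [DecidableEq l] [DecidableEq n] (M : Matrix m m R)
    (Y : l × m × n → R) (i : l) (j : m) (k : n) :
    legAction 1 M 1 Y (i, j, k) = ∑ b, M j b * Y (i, b, k) := by
  simp [legAction_apply, Matrix.one_apply]

theorem legAction_one_one_left [DecidableEq l] [DecidableEq m] (M : Matrix n n R)
    (Y : l × m × n → R) (i : l) (j : m) (k : n) :
    legAction 1 1 M Y (i, j, k) = ∑ c, M k c * Y (i, j, c) := by
  simp [legAction_apply, Matrix.one_apply]

end legAction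

variable {K : Type*} [Field K] {r d₁ d₂ d₃ : ℕ}

section curve

open Polynomial

/-- The matrix curve with value `1` and derivative `M` at `0`. -/
noncomputable def matrixCurve {n : ℕ} (M : Matrix (Fin n) (Fin n) K) :
    Matrix (Fin n) (Fin n) K[X] :=
  (1 : Matrix (Fin n) (Fin n) K[X]) + (X : K[X]) • M.map C

theorem matrixCurve_map_constantCoeff {n : ℕ} (M : Matrix (Fin n) (Fin n) K) :
    (matrixCurve M).map (constantCoeff : K[X] →+* K) = 1 := by
  ext i j
  simp [matrixCurve, Matrix.one_apply, apply_ite (fun p : K[X] => p.coeff 0)]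

theorem matrixCurve_map_coeff_one {n : ℕ} (M : Matrix (Fin n) (Fin n) K) :
    (matrixCurve M).map (lcoeff K 1).toAddMonoidHom = M := by
  ext i j
  simp [matrixCurve, Matrix.one_apply, apply_ite (fun p : K[X] => p.coeff 1), coeff_one]

theorem det_matrixCurve_ne_zero {n : ℕ} (M : Matrix (Fin n) (Fin n) K) :
    (matrixCurve M).det ≠ 0 := fun h => by
  have := RingHom.map_det (constantCoeff : K[X] →+* K) (matrixCurve M)
  rw [h, RingHom.mapMatrix_apply, matrixCurve_map_constantCoeff] at this
  simp at this

theorem le_genericSubrank_of_legSumMatrix_surjective [IsAlgClosed K]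
    (x : TupleIndex r d₁ d₂ d₃ → K)
    (hx : Function.Surjective (legSumMatrix x).mulVec) :
    r ≤ genericSubrank K (r + d₁) (r + d₂) (r + d₃) := by
  have : Infinite K := IsAlgClosed.instInfinite
  obtain ⟨f, hf, hvan | hd⟩ :=
    exists_ne_zero_restricts_or_not_restricts K (r + d₁) (r + d₂) (r + d₃) r
  swap
  · exact (le_genericSubrank_iff K _ _ _).mpr ⟨f, hf, hd⟩
  exfalso
  let Y := borderTensor x
  have hY : corner Y = unitTensor K r := corner_borderTensor x
  rw [← borderSlices_borderTensor x, legSumMatrix_surjective_iff hY] at hx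
  obtain ⟨v, hv⟩ := exists_tangent_aeval_ne_zero hf Y
  obtain ⟨N₁, N₂, N₃, hN⟩ := hx (corner v)
  let M₁ : Matrix (Fin (r + d₁)) (Fin (r + d₁)) K :=
    Matrix.of fun a b => Fin.addCases (fun i => N₁ i b) (fun _ => 0) a
  let M₂ : Matrix (Fin (r + d₂)) (Fin (r + d₂)) K :=
    Matrix.of fun a b => Fin.addCases (fun i => N₂ i b) (fun _ => 0) a
  let M₃ : Matrix (Fin (r + d₃)) (Fin (r + d₃)) K :=
    Matrix.of fun a b => Fin.addCases (fun i => N₃ i b) (fun _ => 0) a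
  let Z := v - (legAction M₁ 1 1 Y + legAction 1 M₂ 1 Y + legAction 1 1 M₃ Y)
  have hZ : corner Z = 0 := by
    funext ⟨i, j, k⟩
    have := hN i j k
    simp only [corner, Z, Pi.sub_apply, Pi.add_apply, legAction_one_one, legAction_one_left_right,
      legAction_one_one_left, Pi.zero_apply] at this ⊢
    simp only [M₁, M₂, M₃, Matrix.of_apply, Fin.addCases_left]
    rw [this, sub_self]
  let T : _ → K[X] := fun p => C (Y p) + X * C (Z p)
  let y := legAction (matrixCurve M₁) (matrixCurve M₂) (matrixCurve M₃) T
  have hT₀ : (constantCoeff : K[X] →+* K) ∘ T = Y := by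
    funext p; simp [T]
  have hT₁ : (lcoeff K 1).toAddMonoidHom ∘ T = Z := by
    funext p; simp [T, coeff_C]
  have hy₀ : ∀ p, (y p).coeff 0 = Y p := fun p => by
    have := congrFun (map_legAction constantCoeff (matrixCurve M₁) (matrixCurve M₂)
      (matrixCurve M₃) T) p
    rwa [hT₀, matrixCurve_map_constantCoeff, matrixCurve_map_constantCoeff,
      matrixCurve_map_constantCoeff, legAction_one] at this
  have hy₁ : ∀ p, (y p).coeff 1 = v p := fun p => by
    have := congrFun (legAction_leibniz constantCoeff (lcoeff K 1).toAddMonoidHom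
      (fun p q => by simp [mul_coeff_one, mul_comm]) (matrixCurve M₁) (matrixCurve M₂)
      (matrixCurve M₃) T) p
    rw [hT₀, hT₁] at this
    simp only [matrixCurve_map_constantCoeff, matrixCurve_map_coeff_one, legAction_one] at this
    refine this.trans ?_
    simp [Z]
  have hne := mul_ne_zero (hv y hy₀ hy₁) (mul_ne_zero (det_matrixCurve_ne_zero M₁)
    (mul_ne_zero (det_matrixCurve_ne_zero M₂) (det_matrixCurve_ne_zero M₃)))
  obtain ⟨t, ht⟩ : ∃ t, eval t (MvPolynomial.aeval y f * ((matrixCurve M₁).det *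
      ((matrixCurve M₂).det * (matrixCurve M₃).det))) ≠ 0 := by
    by_contra! h
    exact hne (Polynomial.funext fun t => by rw [h t, eval_zero])
  simp only [eval_mul, mul_ne_zero_iff] at ht
  obtain ⟨htf, ht₁, ht₂, ht₃⟩ := ht
  have hunit : ∀ {n : ℕ} {M : Matrix (Fin n) (Fin n) K}, eval t (matrixCurve M).det ≠ 0 →
      IsUnit ((matrixCurve M).map (evalRingHom t)).det := fun {n M} h => by
    rw [← RingHom.mapMatrix_apply, ← RingHom.map_det]
    exact isUnit_iff_ne_zero.mpr h
  have hrestr := restricts_legAction_of_corner_eq (Y := evalRingHom t ∘ T) (hunit ht₁) (hunit ht₂)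
    (hunit ht₃) (by
      rw [← hY]
      funext p
      have := congrFun hZ p
      simp only [corner, Pi.zero_apply] at this
      simp [corner, T, this])
  rw [← map_legAction] at hrestr
  have h0 := hvan _ hrestr
  have h1 := AlgHom.map_aeval_eq_eval (Polynomial.aeval t : K[X] →ₐ[K] K) y f
  apply htf
  rw [← Polynomial.coe_aeval_eq_eval]
  exact h1.trans h0

end curve

section converse

open MvPolynomial

theorem exists_legSumMatrix_surjective_of_le_genericSubrank [IsAlgClosed K] [CharZero K]
    (hr : r ≤ genericSubrank K (r + d₁) (r + d₂) (r + d₃)) :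
    ∃ x : TupleIndex r d₁ d₂ d₃ → K, Function.Surjective (legSumMatrix x).mulVec := by
  have : Infinite K := IsAlgClosed.instInfinite
  obtain ⟨f, hf, hfr⟩ := (le_genericSubrank_iff K _ _ _).mp hr
  let σ := (Fin (r + d₁) × Fin (r + d₁)) ⊕ (Fin (r + d₂) × Fin (r + d₂)) ⊕
    (Fin (r + d₃) × Fin (r + d₃)) ⊕ (Fin (r + d₁) × Fin (r + d₂) × Fin (r + d₃))
  let G₁ : Matrix _ _ (MvPolynomial σ K) := fun i j => X (Sum.inl (i, j))
  let G₂ : Matrix _ _ (MvPolynomial σ K) := fun i j => X (Sum.inr (Sum.inl (i, j)))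
  let G₃ : Matrix _ _ (MvPolynomial σ K) := fun i j => X (Sum.inr (Sum.inr (Sum.inl (i, j))))
  let Y : _ → MvPolynomial σ K := fun p =>
    if h : p.1 < r ∧ p.2.1 < r ∧ p.2.2 < r then
      C (unitTensor K r (⟨p.1, h.1⟩, ⟨p.2.1, h.2.1⟩, ⟨p.2.2, h.2.2⟩))
    else X (Sum.inr (Sum.inr (Sum.inr p)))
  have hYc : ∀ i j k, Y (Fin.castAdd d₁ i, Fin.castAdd d₂ j, Fin.castAdd d₃ k) =
      C (unitTensor K r (i, j, k)) := fun i j k => by simp [Y]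
  let φ := legAction G₁ G₂ G₃ Y
  have heval : ∀ pt : σ → K, eval pt ∘ φ = legAction (G₁.map (eval pt)) (G₂.map (eval pt))
      (G₃.map (eval pt)) (eval pt ∘ Y) := fun pt => map_legAction _ _ _ _ _
  have hφ : AlgebraicIndependent K φ := by
    rw [algebraicIndependent_iff]
    intro h hh
    by_contra hne
    obtain ⟨T, hT⟩ := exists_eval_ne_zero (mul_ne_zero hne hf)
    rw [map_mul] at hT
    obtain ⟨g₁, g₂, g₃, S, hS, rfl⟩ := (hfr T (right_ne_zero_of_mul hT)).exists_legAction_eq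
    let pt : σ → K := Sum.elim (fun q => g₁ q.1 q.2) (Sum.elim (fun q => g₂ q.1 q.2)
      (Sum.elim (fun q => g₃ q.1 q.2) S))
    have hY : eval pt ∘ Y = S := by
      funext ⟨a, b, c⟩
      by_cases hp : a < r ∧ b < r ∧ c < r
      · have := congrFun hS (⟨a, hp.1⟩, ⟨b, hp.2.1⟩, ⟨c, hp.2.2⟩)
        simp only [Function.comp_apply, Y, dif_pos hp, eval_C]
        exact this.symm
      · simp only [Function.comp_apply, Y, dif_neg hp]
        exact eval_X _
    have hpt : eval pt ∘ φ = legAction g₁ g₂ g₃ S := by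
      rw [heval, hY]
      congr 1 <;> ext <;> exact eval_X _
    have h1 := AlgHom.map_aeval_eq_eval (MvPolynomial.aeval pt) φ h
    rw [hh, map_zero] at h1
    apply left_ne_zero_of_mul hT
    rw [← hpt]
    exact h1.symm
  obtain ⟨s, hs, hsD⟩ := exists_derivation_of_algebraicIndependent φ hφ
  have hdet : G₁.det ≠ 0 ∧ G₂.det ≠ 0 ∧ G₃.det ≠ 0 := by
    let pt : σ → K := Sum.elim (fun q => (1 : Matrix _ _ K) q.1 q.2)
      (Sum.elim (fun q => (1 : Matrix _ _ K) q.1 q.2)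
        (Sum.elim (fun q => (1 : Matrix _ _ K) q.1 q.2) 0))
    have h : ∀ {n : ℕ} {G : Matrix (Fin n) (Fin n) (MvPolynomial σ K)},
        G.map (eval pt) = 1 → G.det ≠ 0 := fun {n G} hG h0 => by
      have := RingHom.map_det (eval pt) G
      rw [h0, RingHom.mapMatrix_apply, hG] at this
      simp at this
    refine ⟨h ?_, h ?_, h ?_⟩ <;> ext <;> exact eval_X _
  obtain ⟨pt, hpt⟩ := exists_eval_ne_zero (mul_ne_zero hs (mul_ne_zero hdet.1
    (mul_ne_zero hdet.2.1 hdet.2.2)))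
  simp only [map_mul, mul_ne_zero_iff, RingHom.map_det, RingHom.mapMatrix_apply] at hpt
  obtain ⟨hspt, h₁, h₂, h₃⟩ := hpt
  have hYpt : corner (eval pt ∘ Y) = unitTensor K r := by
    funext ⟨i, j, k⟩
    simp [corner, hYc]
  refine ⟨borderSlices (eval pt ∘ Y), (legSumMatrix_surjective_iff hYpt).mpr fun v => ?_⟩
  let V : Tensor K (r + d₁) (r + d₂) (r + d₃) := fun p =>
    if h : p.1 < r ∧ p.2.1 < r ∧ p.2.2 < r then
      v (⟨p.1, h.1⟩, ⟨p.2.1, h.2.1⟩, ⟨p.2.2, h.2.2⟩) else 0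
  obtain ⟨D, hDC, hD, hDφ⟩ := hsD pt hspt (legAction (G₁.map (eval pt)) (G₂.map (eval pt))
      (G₃.map (eval pt)) V)
  have key := legAction_leibniz (eval pt) D hD G₁ G₂ G₃ Y
  rw [show D ∘ legAction G₁ G₂ G₃ Y = _ from _root_.funext hDφ] at key
  have key' := congrArg (legAction (G₁.map (eval pt))⁻¹ (G₂.map (eval pt))⁻¹
    (G₃.map (eval pt))⁻¹) key
  simp only [legAction_add, legAction_legAction,
    Matrix.nonsing_inv_mul _ (isUnit_iff_ne_zero.mpr h₁),
    Matrix.nonsing_inv_mul _ (isUnit_iff_ne_zero.mpr h₂),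
    Matrix.nonsing_inv_mul _ (isUnit_iff_ne_zero.mpr h₃), legAction_one] at key'
  refine ⟨((G₁.map (eval pt))⁻¹ * G₁.map D).submatrix (Fin.castAdd d₁) id,
    ((G₂.map (eval pt))⁻¹ * G₂.map D).submatrix (Fin.castAdd d₂) id,
    ((G₃.map (eval pt))⁻¹ * G₃.map D).submatrix (Fin.castAdd d₃) id, fun i j k => ?_⟩
  have := congrFun key' (Fin.castAdd d₁ i, Fin.castAdd d₂ j, Fin.castAdd d₃ k)
  simp only [Pi.add_apply, legAction_one_one, legAction_one_left_right,
    legAction_one_one_left, Function.comp_apply, hYc, hDC, add_zero] at this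
  simp only [Matrix.submatrix_apply, id, Function.comp_apply]
  rw [← this]
  simp [V]

end converse

open MvPolynomial

theorem finrank_span_eq_iff {K : Type*} [Field K] {r d : ℕ} (m : Fin d → Fin r → Fin r → K) :
    Module.finrank K (Submodule.span K (Set.range fun a => Matrix.of fun i j => m a i j)) = d ↔
      Function.Surjective
        (Matrix.of fun (a : Fin d) (p : Fin r × Fin r) => m a p.1 p.2).mulVec := by
  let e := (LinearEquiv.curry K K (Fin r) (Fin r)).trans (Matrix.ofLinearEquiv K)
  rw [Matrix.mulVec_surjective_iff_linearIndependent_row,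
    ← LinearMap.linearIndependent_iff (e : _ →ₗ[K] Matrix (Fin r) (Fin r) K) e.ker,
    linearIndependent_iff_card_eq_finrank_span, Fintype.card_fin, eq_comm]
  rfl

theorem exists_surjective_mulVec {K : Type*} [Field K] {r d : ℕ} (hd : d ≤ r ^ 2) :
    ∃ m : Fin d × Fin r × Fin r → K,
      Function.Surjective (Matrix.of fun (a : Fin d) (p : Fin r × Fin r) => m (a, p)).mulVec := by
  obtain ⟨e⟩ := Function.Embedding.nonempty_of_card_le (α := Fin d) (β := Fin r × Fin r)
    (by simpa [sq] using hd)
  refine ⟨fun q => if e q.1 = q.2 then 1 else 0, ?_⟩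
  rw [Matrix.mulVec_surjective_iff_linearIndependent_row]
  convert (Pi.basisFun K (Fin r × Fin r)).linearIndependent.comp e e.injective using 1
  ext a p
  simp [Pi.single_apply, eq_comm]

theorem spans_mem_grassmannian_iff (x : TupleIndex r d₁ d₂ d₃ → K) :
    spans x ∈ grassmannian K r d₁ ×ˢ grassmannian K r d₂ ×ˢ grassmannian K r d₃ ↔
      Function.Surjective
        (Matrix.of fun (a : Fin d₁) (p : Fin r × Fin r) => x (Sum.inl (a, p))).mulVec ∧
      Function.Surjective
        (Matrix.of fun (a : Fin d₂) (p : Fin r × Fin r) => x (Sum.inr (Sum.inl (a, p)))).mulVec ∧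
      Function.Surjective
        (Matrix.of fun (a : Fin d₃) (p : Fin r × Fin r) => x (Sum.inr (Sum.inr (a, p)))).mulVec :=
  and_congr (finrank_span_eq_iff fun a i j => x (Sum.inl (a, i, j)))
    (and_congr (finrank_span_eq_iff fun a i j => x (Sum.inr (Sum.inl (a, i, j))))
      (finrank_span_eq_iff fun a i j => x (Sum.inr (Sum.inr (a, i, j)))))

theorem isZariskiOpen_spans_mem_grassmannian :
    IsZariskiOpen {x : TupleIndex r d₁ d₂ d₃ → K | spans x ∈
      grassmannian K r d₁ ×ˢ grassmannian K r d₂ ×ˢ grassmannian K r d₃} := by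
  simp only [spans_mem_grassmannian_iff]
  convert (isZariskiOpen_mulVec_surjective (K := K) (σ := TupleIndex r d₁ d₂ d₃)
    (Matrix.of fun (a : Fin d₁) (p : Fin r × Fin r) => X (Sum.inl (a, p)))).inter
    ((isZariskiOpen_mulVec_surjective
      (Matrix.of fun (a : Fin d₂) (p : Fin r × Fin r) => X (Sum.inr (Sum.inl (a, p))))).inter
    (isZariskiOpen_mulVec_surjective
      (Matrix.of fun (a : Fin d₃) (p : Fin r × Fin r) => X (Sum.inr (Sum.inr (a, p)))))) using 1
  ext x
  have h : ∀ {d : ℕ} (s : Fin d × Fin r × Fin r → TupleIndex r d₁ d₂ d₃),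
      (Matrix.of fun (a : Fin d) (p : Fin r × Fin r) =>
        (X (s (a, p)) : MvPolynomial (TupleIndex r d₁ d₂ d₃) K)).map (eval x) =
      Matrix.of fun (a : Fin d) (p : Fin r × Fin r) => x (s (a, p)) := fun s => by
    ext a p
    exact eval_X _
  have h' : ∀ {d : ℕ} (s : Fin d × Fin r × Fin r → TupleIndex r d₁ d₂ d₃),
      Function.Surjective (Matrix.of fun (a : Fin d) (p : Fin r × Fin r) => x (s (a, p))).mulVec ↔
      Function.Surjective ((Matrix.of fun (a : Fin d) (p : Fin r × Fin r) =>
        (X (s (a, p)) : MvPolynomial (TupleIndex r d₁ d₂ d₃) K)).map (eval x)).mulVec :=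
    fun s => by rw [h]
  exact and_congr (h' Sum.inl) (and_congr (h' (Sum.inr ∘ Sum.inl)) (h' (Sum.inr ∘ Sum.inr)))

theorem forGenericSubspaces_of_legSumMatrix_surjective [Infinite K] (h₁ : d₁ ≤ r ^ 2)
    (h₂ : d₂ ≤ r ^ 2) (h₃ : d₃ ≤ r ^ 2) (x : TupleIndex r d₁ d₂ d₃ → K)
    (hx : Function.Surjective (legSumMatrix x).mulVec) :
    ForGenericSubspaces K r d₁ d₂ d₃ (fun X₁ X₂ X₃ =>
      tensorLeg₁ r X₁ ⊔ tensorLeg₂ r X₂ ⊔ tensorLeg₃ r X₃ ⊔ distinctVanishing K r = ⊤) := by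
  have hopen : IsZariskiOpen {x : TupleIndex r d₁ d₂ d₃ → K |
      Function.Surjective (legSumMatrix x).mulVec} := by
    convert isZariskiOpen_mulVec_surjective (legSumMatrix
      (fun q => (X q : MvPolynomial (TupleIndex r d₁ d₂ d₃) K))) using 1
    ext x
    simp only [legSumMatrix_map, Function.comp_def, eval_X]
  obtain ⟨m₁, hm₁⟩ := exists_surjective_mulVec (K := K) h₁
  obtain ⟨m₂, hm₂⟩ := exists_surjective_mulVec (K := K) h₂
  obtain ⟨m₃, hm₃⟩ := exists_surjective_mulVec (K := K) h₃
  obtain ⟨y, hy, hy'⟩ := isZariskiOpen_spans_mem_grassmannian.inter_nonempty hopen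
    ⟨Sum.elim m₁ (Sum.elim m₂ m₃), (spans_mem_grassmannian_iff _).mpr ⟨hm₁, hm₂, hm₃⟩⟩ ⟨x, hx⟩
  refine ⟨{X | X ∈ grassmannian K r d₁ ×ˢ grassmannian K r d₂ ×ˢ grassmannian K r d₃ ∧
    tensorLeg₁ r X.1 ⊔ tensorLeg₂ r X.2.1 ⊔ tensorLeg₃ r X.2.2 ⊔ distinctVanishing K r = ⊤},
    ⟨spans y, hy, (tensorLeg_sup_eq_top_iff y).mpr hy'⟩, ⟨fun X hX => hX.1, ?_⟩,
    fun X hX => hX.2⟩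
  convert isZariskiOpen_spans_mem_grassmannian.inter hopen using 1
  ext z
  exact and_congr Iff.rfl (tensorLeg_sup_eq_top_iff z)

theorem exists_span_range_eq_of_mem_grassmannian {d : ℕ} {V : MatSubspace K r}
    (hV : V ∈ grassmannian K r d) :
    ∃ m : Fin d × Fin r × Fin r → K,
      Submodule.span K (Set.range fun a => Matrix.of fun i j => m (a, i, j)) = V := by
  let b := Module.finBasisOfFinrankEq K V hV
  refine ⟨fun q => (b q.1 : Matrix (Fin r) (Fin r) K) q.2.1 q.2.2, ?_⟩
  change Submodule.span K (Set.range (V.subtype ∘ b)) = V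
  rw [Set.range_comp, Submodule.span_image, b.span_eq, Submodule.map_top, Submodule.range_subtype]

theorem exists_legSumMatrix_surjective_of_forGenericSubspaces
    (h : ForGenericSubspaces K r d₁ d₂ d₃ (fun X₁ X₂ X₃ =>
      tensorLeg₁ r X₁ ⊔ tensorLeg₂ r X₂ ⊔ tensorLeg₃ r X₃ ⊔ distinctVanishing K r = ⊤)) :
    ∃ x : TupleIndex r d₁ d₂ d₃ → K, Function.Surjective (legSumMatrix x).mulVec := by
  obtain ⟨U, ⟨⟨V₁, V₂, V₃⟩, hV⟩, ⟨hU, -⟩, hP⟩ := h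
  obtain ⟨hV₁, hV₂, hV₃⟩ := hU hV
  obtain ⟨m₁, rfl⟩ := exists_span_range_eq_of_mem_grassmannian hV₁
  obtain ⟨m₂, rfl⟩ := exists_span_range_eq_of_mem_grassmannian hV₂
  obtain ⟨m₃, rfl⟩ := exists_span_range_eq_of_mem_grassmannian hV₃
  exact ⟨Sum.elim m₁ (Sum.elim m₂ m₃), (tensorLeg_sup_eq_top_iff _).mp (hP _ hV)⟩

end GenericSubrank

theorem theorem3p7 (K : Type*) [Field K] [IsAlgClosed K] (n₁ n₂ n₃ r : ℕ)
    (h₁ : r ≤ n₁) (h₂ : r ≤ n₂) (h₃ : r ≤ n₃)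
    (h₁' : n₁ - r ≤ r ^ 2) (h₂' : n₂ - r ≤ r ^ 2) (h₃' : n₃ - r ≤ r ^ 2) :
    GenericSubrank.IsGenericSubrank K n₁ n₂ n₃ (GenericSubrank.genericSubrank K n₁ n₂ n₃) ∧
    (GenericSubrank.ForGenericSubspaces K r (n₁ - r) (n₂ - r) (n₃ - r)
        (fun X₁ X₂ X₃ =>
          GenericSubrank.tensorLeg₁ r X₁ ⊔ GenericSubrank.tensorLeg₂ r X₂ ⊔
            GenericSubrank.tensorLeg₃ r X₃ ⊔ GenericSubrank.distinctVanishing K r = ⊤) →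
      r ≤ GenericSubrank.genericSubrank K n₁ n₂ n₃) ∧
    (CharZero K → r ≤ GenericSubrank.genericSubrank K n₁ n₂ n₃ →
      GenericSubrank.ForGenericSubspaces K r (n₁ - r) (n₂ - r) (n₃ - r)
        (fun X₁ X₂ X₃ =>
          GenericSubrank.tensorLeg₁ r X₁ ⊔ GenericSubrank.tensorLeg₂ r X₂ ⊔
            GenericSubrank.tensorLeg₃ r X₃ ⊔ GenericSubrank.distinctVanishing K r = ⊤)) := by
  have : Infinite K := IsAlgClosed.instInfinite
  obtain ⟨d₁, rfl⟩ := Nat.exists_eq_add_of_le h₁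
  obtain ⟨d₂, rfl⟩ := Nat.exists_eq_add_of_le h₂
  obtain ⟨d₃, rfl⟩ := Nat.exists_eq_add_of_le h₃
  simp only [Nat.add_sub_cancel_left] at h₁' h₂' h₃' ⊢
  refine ⟨GenericSubrank.isGenericSubrank_genericSubrank K _ _ _, fun h => ?_, fun _ hr => ?_⟩
  · obtain ⟨x, hx⟩ := GenericSubrank.exists_legSumMatrix_surjective_of_forGenericSubspaces h
    exact GenericSubrank.le_genericSubrank_of_legSumMatrix_surjective x hx
  · obtain ⟨x, hx⟩ := GenericSubrank.exists_legSumMatrix_surjective_of_le_genericSubrank hr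
    exact GenericSubrank.forGenericSubspaces_of_legSumMatrix_surjective h₁' h₂' h₃' x hx
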